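/- For a positive semidefinite (PSD) matrix $A\in\mathbb{R}^{n\times n}$ let $$\mathrm{IQP}^*(A)=\max_{x\in\{-1,1\}^n}x^{\mathsf T}Ax,\qquad \mathrm{SDP}^*(A)=\max\{\operatorname{tr}(AS): S\in\mathbb{R}^{n\times n}\text{ symmetric},\ S\succeq 0,\ S_{ii}=1\ \text{for all } i\}.$$ For unit vectors $v_1,\dots,v_n\in\mathbb{R}^p$ let $A(v)\in\mathbb{R}^{n\times n}$ be the matrix with entries $A(v)_{ij}=v_i^{\mathsf T}v_j/n$. Write $f(n)=\tilde O(g(n))$ if $f(n)=O(g(n)(\log n)^k)$ as $n\to\infty$ for some fixed $k\in\mathbb{N}$. Let $p(n)$, $n\ge 1$, be any positive integers with $p(n)=\Theta(n^{1/3})$ (for example $p(n)=\lceil n^{1/3}\rceil$). Then there is a function $\mathrm{err}(n)=\tilde O(1/n^{1/3})$ such that: 1. for every $n\ge 1$ there are unit vectors $v_1,\dots,v_n\in\mathbb{R}^{p(n)}$ for which $A=A(v)$ is PSD, $\mathrm{SDP}^*(A)>0$, and $$\frac{\mathrm{IQP}^*(A)}{\mathrm{SDP}^*(A)}\le\frac{2}{\pi}+\mathrm{err}(n);$$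 2. if $v_1,\dots,v_n$ are independent and uniformly distributed on the unit sphere of $\mathbb{R}^{p(n)}$, then the three properties in 1 hold for $A=A(v)$ with probability tending to $1$ as $n\to\infty$. -/

import Mathlib

open MeasureTheory Filter Topology Asymptotics

noncomputable section

namespace PSDGrothendieck

/-- The objective `xᵀ A x` of the integer quadratic program. -/
def IQP {n : ℕ} (A : Matrix (Fin n) (Fin n) ℝ) (x : Fin n → ℝ) : ℝ :=
  x ⬝ᵥ A.mulVec x

/-- The discrete hypercube `{-1, 1}ⁿ`. -/
def hypercube (n : ℕ) : Set (Fin n → ℝ) :=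
  {x | ∀ i, x i = -1 ∨ x i = 1}

/-- The objective `tr (A S)` of the semidefinite relaxation. -/
def SDP {n : ℕ} (A S : Matrix (Fin n) (Fin n) ℝ) : ℝ :=
  (A * S).trace

/-- The feasible set of the semidefinite relaxation: symmetric `S ⪰ 0` with unit diagonal. -/
def elliptope (n : ℕ) : Set (Matrix (Fin n) (Fin n) ℝ) :=
  {S | S.PosSemidef ∧ ∀ i, S i i = 1}

/-- The integer optimum `max_{x ∈ {-1,1}ⁿ} xᵀ A x`; it is attained, see `iqpOpt_isGreatest`. -/
def iqpOpt {n : ℕ} (A : Matrix (Fin n) (Fin n) ℝ) : ℝ :=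
  sSup (IQP A '' hypercube n)

/-- The optimum of the semidefinite relaxation; it is attained, see `sdpOpt_isGreatest`. -/
def sdpOpt {n : ℕ} (A : Matrix (Fin n) (Fin n) ℝ) : ℝ :=
  sSup (SDP A '' elliptope n)

/-- The ratio of the integer optimum to the optimum of the semidefinite relaxation. -/
def optRatio {n : ℕ} (A : Matrix (Fin n) (Fin n) ℝ) : ℝ :=
  iqpOpt A / sdpOpt A

/-- The unit sphere of `ℝᵖ` with the Euclidean norm. -/
abbrev UnitSphere (p : ℕ) : Type :=
  Metric.sphere (0 : EuclideanSpace ℝ (Fin p)) 1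

/-- The uniform probability measure on the unit sphere of `ℝᵖ` (for `p ≥ 1`):
normalized surface measure. -/
def uniformSphere (p : ℕ) : Measure (UnitSphere p) :=
  ((volume : Measure (EuclideanSpace ℝ (Fin p))).toSphere Set.univ)⁻¹ •
    (volume : Measure (EuclideanSpace ℝ (Fin p))).toSphere

/-- The law of `n` independent uniformly random unit vectors of `ℝᵖ`. -/
def randomUnitVectors (n p : ℕ) : Measure (Fin n → UnitSphere p) :=
  Measure.pi fun _ => uniformSphere p

/-- The instance `A i j = vᵢᵀ vⱼ / n` built from unit vectors `v₁, …, vₙ` of `ℝᵖ`. -/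
def gramInstance {n p : ℕ} (v : Fin n → UnitSphere p) : Matrix (Fin n) (Fin n) ℝ :=
  Matrix.of fun i j =>
    inner ℝ (v i : EuclideanSpace ℝ (Fin p)) (v j : EuclideanSpace ℝ (Fin p)) / (n : ℝ)

/-- `f = Õ(g)`: `f(n) = O(g(n) (log n)ᵏ)` as `n → ∞`, for some fixed `k`. -/
def IsSoftO (f g : ℕ → ℝ) : Prop :=
  ∃ k : ℕ, f =O[atTop] fun n => g n * Real.log (n : ℝ) ^ k

theorem hypercube_finite (n : ℕ) : (hypercube n).Finite := by
  have h : (Set.univ.pi fun _ : Fin n => ({-1, 1} : Set ℝ)).Finite :=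
    Set.Finite.pi fun _ => by simp
  refine h.subset fun x hx i _ => ?_
  simpa using hx i

theorem iqpOpt_isGreatest {n : ℕ} (A : Matrix (Fin n) (Fin n) ℝ) :
    IsGreatest (IQP A '' hypercube n) (iqpOpt A) := by
  have hf := (hypercube_finite n).image (IQP A)
  have hne : (IQP A '' hypercube n).Nonempty := ⟨_, fun _ => 1, fun _ => Or.inr rfl, rfl⟩
  exact ⟨hne.csSup_mem hf, fun y hy => le_csSup hf.bddAbove hy⟩

theorem isCompact_elliptope (n : ℕ) : IsCompact (elliptope n) := by
  have hbd : elliptope n ⊆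
      (Set.univ.pi fun _ : Fin n => Set.univ.pi fun _ : Fin n => Set.Icc (-1 : ℝ) 1) := by
    rintro S ⟨hS, hd⟩ i - j -
    have hsymm : S j i = S i j := by simpa using hS.isHermitian.apply i j
    have key : ∀ c : ℝ, 0 ≤ S i i + 2 * c * S i j + c ^ 2 * S j j := by
      intro c
      have h := hS.dotProduct_mulVec_nonneg (Pi.single i 1 + Pi.single j c)
      simp [Matrix.mulVec_add, dotProduct_add, add_dotProduct, Matrix.mulVec_single] at h
      rw [hsymm] at h
      linarith
    have h1 := key 1
    have h2 := key (-1)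
    rw [hd i, hd j] at h1 h2
    exact ⟨by linarith, by linarith⟩
  have hK : IsCompact
      (Set.univ.pi fun _ : Fin n => Set.univ.pi fun _ : Fin n => Set.Icc (-1 : ℝ) 1) :=
    isCompact_univ_pi fun _ => isCompact_univ_pi fun _ => isCompact_Icc
  refine IsCompact.of_isClosed_subset hK ?_ hbd
  have heq : elliptope n = {S : Matrix (Fin n) (Fin n) ℝ | S.transpose = S} ∩
      ((⋂ x : Fin n → ℝ, {S | 0 ≤ x ⬝ᵥ S.mulVec x}) ∩ ⋂ i, {S | S i i = 1}) := by
    ext S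
    simp [elliptope, Matrix.posSemidef_iff_dotProduct_mulVec, Matrix.IsHermitian, and_assoc]
  rw [heq]
  refine (isClosed_eq (by fun_prop) continuous_id).inter
    ((isClosed_iInter fun x => isClosed_le continuous_const ?_).inter
      (isClosed_iInter fun i => isClosed_eq ?_ continuous_const))
  · fun_prop
  · exact (continuous_apply i).comp (continuous_apply i)

theorem sdpOpt_isGreatest {n : ℕ} (A : Matrix (Fin n) (Fin n) ℝ) :
    IsGreatest (SDP A '' elliptope n) (sdpOpt A) := by
  have hc : Continuous (SDP A) := by
    unfold SDP
    fun_prop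
  exact ((isCompact_elliptope n).image hc).isGreatest_sSup
    ⟨_, 1, ⟨Matrix.PosSemidef.one, fun i => by simp⟩, rfl⟩

end PSDGrothendieck

end

namespace PSDGrothendieck

/-! For signs `x`, the objective is `‖∑ xᵢ vᵢ‖² / n`. Choosing signs and a direction jointly, its
maximum is governed by the largest value of `∑ |⟨u, vᵢ⟩|` over unit `u`. The feasible matrix `S = n
A` gives `SDP* ≥ n / p` for every choice of the `vᵢ`. So if `∑ |⟨u, vᵢ⟩| ≤ n s` for all unit `u`,
the ratio is at most `p s²` (`optRatio_gramInstance_le`). Positive semidefiniteness and `SDP* > 0`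
are deterministic; only this bound on the sums is random.

For a uniform `v`, Gaussian integrals in polar coordinates give `E |⟨u, v⟩| ≤ M = √(2/π) √(p+1) / p`
and `E ⟨u, v⟩² = 1/p`. A Chernoff bound for fixed `u` and a union bound over a net of `(2n+1)^p`
directions allow `s = M + d + p/n`, where `d` is the deviation and `p/n` the net error
(`measure_compl_optRatio_le`). With `d = log n / √n` failure has probability at most `1/n` for large
`n`.

Expanding, `p M² = 2/π + (2/π)/p`, and the main cross term is of order `√p d = √(p/n) log n`. The
exponent `1/3` balances `1/p` against `√(p/n)`. -/

/-! ### Moments of one coordinate on the sphere -/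

/-- Log-convexity of Gamma at the midpoint `x + 1` of `x + 1/2` and `x + 3/2`, combined with the
functional equation. -/
theorem Gamma_div_Gamma_add_half_le {x : ℝ} (hx : 0 < x) :
    Real.Gamma x / Real.Gamma (x + 1 / 2) ≤ √(x + 1 / 2) / x := by
  have h := Real.Gamma_mul_add_mul_le_rpow_Gamma_mul_rpow_Gamma
    (s := x + 1 / 2) (t := x + 1 / 2 + 1) (a := 1 / 2) (b := 1 / 2)
    (by positivity) (by positivity) (by norm_num) (by norm_num) (by norm_num)
  have hG : 0 < Real.Gamma (x + 1 / 2) := Real.Gamma_pos_of_pos (by positivity)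
  rw [show 1 / 2 * (x + 1 / 2) + 1 / 2 * (x + 1 / 2 + 1) = x + 1 by ring,
    Real.Gamma_add_one hx.ne', Real.Gamma_add_one (by positivity), ← Real.sqrt_eq_rpow,
    ← Real.sqrt_eq_rpow, ← Real.sqrt_mul hG.le,
    show Real.Gamma (x + 1 / 2) * ((x + 1 / 2) * Real.Gamma (x + 1 / 2)) =
      (x + 1 / 2) * Real.Gamma (x + 1 / 2) ^ 2 by ring,
    Real.sqrt_mul (by positivity), Real.sqrt_sq hG.le] at h
  rw [div_le_div_iff₀ hG hx]
  linarith

theorem integral_Ioi_pow_mul_exp_neg_sq (k : ℕ) :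
    ∫ r in Set.Ioi (0 : ℝ), r ^ k * Real.exp (-r ^ 2) = Real.Gamma ((k + 1) / 2) / 2 := by
  have h := integral_rpow_mul_exp_neg_rpow (p := 2) (q := k) (by norm_num)
    (by have : (0 : ℝ) ≤ k := k.cast_nonneg
        linarith)
  simp only [Real.rpow_natCast, Real.rpow_ofNat] at h
  rw [h]; ring

theorem integral_abs_pow_mul_exp_neg_sq (k : ℕ) :
    ∫ x : ℝ, |x| ^ k * Real.exp (-x ^ 2) = Real.Gamma ((k + 1) / 2) := by
  have h := integral_comp_abs (f := fun r : ℝ => r ^ k * Real.exp (-r ^ 2))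
  simp only [sq_abs] at h
  rw [h, integral_Ioi_pow_mul_exp_neg_sq]; ring

/-- Rotation invariance: in an orthonormal basis starting with `u` the integrand splits into
one-dimensional Gaussian integrals. -/
theorem integral_abs_inner_pow_mul_exp_neg_norm_sq {p : ℕ} (u : EuclideanSpace ℝ (Fin p))
    (hu : ‖u‖ = 1) (k : ℕ) :
    ∫ x : EuclideanSpace ℝ (Fin p), |inner ℝ u x| ^ k * Real.exp (-‖x‖ ^ 2) =
      Real.Gamma ((k + 1) / 2) * √Real.pi ^ (p - 1) := by
  obtain ⟨p, rfl⟩ : ∃ q, p = q + 1 := by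
    refine Nat.exists_eq_succ_of_ne_zero ?_
    rintro rfl
    simp [Subsingleton.elim u 0] at hu
  obtain ⟨b, hb⟩ := Orthonormal.exists_orthonormalBasis_extension_of_card_eq (𝕜 := ℝ)
    (E := EuclideanSpace ℝ (Fin (p + 1))) (ι := Fin (p + 1)) (by simp)
    (v := fun _ => u) (s := {0}) (by
      rw [orthonormal_iff_ite]
      rintro ⟨i, rfl⟩ ⟨j, rfl⟩
      simp [hu])
  have hb0 : b 0 = u := hb 0 rfl
  have h1 : ∀ x, |inner ℝ u x| ^ k * Real.exp (-‖x‖ ^ 2) =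
      (fun y : EuclideanSpace ℝ (Fin (p + 1)) => |y 0| ^ k * Real.exp (-‖y‖ ^ 2)) (b.repr x) := by
    intro x
    simp [b.repr_apply_apply, hb0]
  refine (integral_congr_ae (.of_forall h1)).trans ((b.measurePreserving_repr.integral_comp
    b.repr.toHomeomorph.measurableEmbedding
    (fun y : EuclideanSpace ℝ (Fin (p + 1)) => |y 0| ^ k * Real.exp (-‖y‖ ^ 2))).trans ?_)
  rw [← (PiLp.volume_preserving_toLp (Fin (p + 1))).integral_comp
      (MeasurableEquiv.toLp 2 (Fin (p + 1) → ℝ)).measurableEmbedding]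
  have h2 : ∀ y : Fin (p + 1) → ℝ,
      |(WithLp.toLp 2 y : EuclideanSpace ℝ (Fin (p + 1))) 0| ^ k *
        Real.exp (-‖(WithLp.toLp 2 y : EuclideanSpace ℝ (Fin (p + 1)))‖ ^ 2) =
      ∏ i, (fun (i : Fin (p + 1)) (t : ℝ) =>
        |t| ^ (if i = 0 then k else 0) * Real.exp (-t ^ 2)) i (y i) := by
    intro y
    rw [Finset.prod_mul_distrib, ← Real.exp_sum, EuclideanSpace.norm_sq_eq]
    simp
  simp_rw [h2]
  rw [integral_fintype_prod_volume_eq_prod (fun (i : Fin (p + 1)) (t : ℝ) =>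
        |t| ^ (if i = 0 then k else 0) * Real.exp (-t ^ 2))]
  simp_rw [integral_abs_pow_mul_exp_neg_sq]
  simp [Fin.prod_univ_succ, Fin.succ_ne_zero, -one_div, Real.Gamma_one_half_eq]

/-- The same Gaussian integral in polar coordinates: the radial factor integrates `r ^ (p - 1 + k) *
exp (-r ^ 2)`. -/
theorem integral_toSphere_abs_inner_pow {p : ℕ} (u : EuclideanSpace ℝ (Fin p))
    (hu : ‖u‖ = 1) (k : ℕ) :
    (∫ v : UnitSphere p, |inner ℝ u (v : EuclideanSpace ℝ (Fin p))| ^ k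
      ∂(volume : Measure (EuclideanSpace ℝ (Fin p))).toSphere) * (Real.Gamma ((p + k) / 2) / 2) =
      Real.Gamma ((k + 1) / 2) * √Real.pi ^ (p - 1) := by
  have hp : 1 ≤ p := by
    rw [Nat.one_le_iff_ne_zero]
    rintro rfl
    simp [Subsingleton.elim u 0] at hu
  have : Nontrivial (EuclideanSpace ℝ (Fin p)) := ⟨u, 0, by rintro rfl; simp at hu⟩
  set μ := (volume : Measure (EuclideanSpace ℝ (Fin p)))
  rw [← integral_abs_inner_pow_mul_exp_neg_norm_sq u hu k]
  symm
  calc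
    ∫ x, |inner ℝ u x| ^ k * Real.exp (-‖x‖ ^ 2) ∂μ
      = ∫ x : ({(0)}ᶜ : Set (EuclideanSpace ℝ (Fin p))),
          |inner ℝ u x.1| ^ k * Real.exp (-‖x.1‖ ^ 2) ∂(μ.comap (↑)) := by
      rw [integral_subtype_comap (measurableSet_singleton _).compl
        fun x => |inner ℝ u x| ^ k * Real.exp (-‖x‖ ^ 2), restrict_compl_singleton]
    _ = ∫ x, |inner ℝ u x.1.1| ^ k * (x.2.1 ^ k * Real.exp (-x.2.1 ^ 2))
          ∂μ.toSphere.prod (.volumeIoiPow (p - 1)) := by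
      have h := μ.measurePreserving_homeomorphUnitSphereProd.integral_comp
        (Homeomorph.measurableEmbedding _)
        (fun x => |inner ℝ u x.1.1| ^ k * (x.2.1 ^ k * Real.exp (-x.2.1 ^ 2)))
      rw [finrank_euclideanSpace_fin] at h
      rw [← h]
      refine integral_congr_ae (.of_forall fun x => ?_)
      have hx : ‖x.1‖ ≠ 0 := norm_ne_zero_iff.2 x.2
      simp only [homeomorphUnitSphereProd_apply_fst_coe, homeomorphUnitSphereProd_apply_snd_coe,
        inner_smul_right, abs_mul, abs_inv, abs_norm, mul_pow, inv_pow]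
      field_simp
    _ = (∫ v : UnitSphere p, |inner ℝ u v.1| ^ k ∂μ.toSphere) *
          ∫ r : Set.Ioi (0 : ℝ), r.1 ^ k * Real.exp (-r.1 ^ 2) ∂.volumeIoiPow (p - 1) :=
      integral_prod_mul (fun v : UnitSphere p => |inner ℝ u v.1| ^ k)
        (fun r : Set.Ioi (0 : ℝ) => r.1 ^ k * Real.exp (-r.1 ^ 2))
    _ = _ := by
      congr 1
      simp only [Measure.volumeIoiPow, ENNReal.ofReal]
      rw [integral_withDensity_eq_integral_smul (by fun_prop),
        integral_subtype_comap measurableSet_Ioi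
          fun a => Real.toNNReal (a ^ (p - 1)) • (a ^ k * Real.exp (-a ^ 2))]
      rw [show ((p : ℝ) + k) / 2 = ((p - 1 + k : ℕ) + 1 : ℝ) / 2 by push_cast [hp]; ring,
        ← integral_Ioi_pow_mul_exp_neg_sq]
      refine setIntegral_congr_fun measurableSet_Ioi fun x hx => ?_
      rw [NNReal.smul_def, Real.coe_toNNReal _ (pow_nonneg hx.out.le _), smul_eq_mul, pow_add,
        mul_assoc]

theorem isProbabilityMeasure_uniformSphere {p : ℕ} (hp : 1 ≤ p) :
    IsProbabilityMeasure (uniformSphere p) := by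
  have : Nonempty (Fin p) := ⟨⟨0, hp⟩⟩
  constructor
  rw [uniformSphere, Measure.smul_apply, smul_eq_mul]
  exact ENNReal.inv_mul_cancel (by simp [-Measure.toSphere_apply_univ]) (measure_ne_top _ _)

theorem integral_uniformSphere_abs_inner_pow {p : ℕ} (u : EuclideanSpace ℝ (Fin p))
    (hu : ‖u‖ = 1) (k : ℕ) :
    ∫ v : UnitSphere p, |inner ℝ u (v : EuclideanSpace ℝ (Fin p))| ^ k ∂uniformSphere p =
      Real.Gamma ((k + 1) / 2) / √Real.pi *
        (Real.Gamma (p / 2) / Real.Gamma ((p + k) / 2)) := by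
  have hp : 1 ≤ p := by
    rw [Nat.one_le_iff_ne_zero]
    rintro rfl
    simp [Subsingleton.elim u 0] at hu
  have hp0 : (0 : ℝ) < p := by exact_mod_cast hp
  -- The case `k = 0` computes the total surface mass, the normalizing constant.
  have h0 := integral_toSphere_abs_inner_pow u hu 0
  have hk := integral_toSphere_abs_inner_pow u hu k
  have hG0 : 0 < Real.Gamma (p / 2) := Real.Gamma_pos_of_pos (by positivity)
  have hGk : 0 < Real.Gamma ((p + k) / 2) := Real.Gamma_pos_of_pos (by positivity)
  have hpi : 0 < √Real.pi := by positivity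
  simp only [pow_zero, integral_const, smul_eq_mul, mul_one, Nat.cast_zero, add_zero, zero_add,
    Real.Gamma_one_half_eq] at h0
  rw [uniformSphere, integral_smul_measure, ENNReal.toReal_inv, smul_eq_mul]
  rw [Measure.real] at h0
  set s := ((volume : Measure (EuclideanSpace ℝ (Fin p))).toSphere Set.univ).toReal
  set J := ∫ v : UnitSphere p, |inner ℝ u (v : EuclideanSpace ℝ (Fin p))| ^ k
      ∂(volume : Measure (EuclideanSpace ℝ (Fin p))).toSphere
  have hs : s ≠ 0 := by
    intro hs
    rw [hs] at h0
    have : 0 < √Real.pi * √Real.pi ^ (p - 1) := by positivity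
    linarith
  set q := √Real.pi ^ (p - 1)
  have hq : 0 < q := by positivity
  have e1 : s = √Real.pi * q * 2 / Real.Gamma (p / 2) := by field_simp; linarith
  have e2 : J = Real.Gamma ((k + 1) / 2) * q * 2 / Real.Gamma ((p + k) / 2) := by
    field_simp; linarith
  rw [e1, e2]
  field_simp

theorem integral_uniformSphere_abs_inner_le {p : ℕ} (u : EuclideanSpace ℝ (Fin p))
    (hu : ‖u‖ = 1) :
    ∫ v : UnitSphere p, |inner ℝ u (v : EuclideanSpace ℝ (Fin p))| ∂uniformSphere p ≤
      √(2 / Real.pi) * (√(p + 1) / p) := by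
  have hp : 0 < p := by
    rw [Nat.pos_iff_ne_zero]
    rintro rfl
    simp [Subsingleton.elim u 0] at hu
  have hp0 : (0 : ℝ) < p := by exact_mod_cast hp
  have h := integral_uniformSphere_abs_inner_pow u hu 1
  simp only [pow_one, Nat.cast_one] at h
  rw [h]
  have h2 := Gamma_div_Gamma_add_half_le (x := p / 2) (by positivity)
  rw [show (p : ℝ) / 2 + 1 / 2 = (p + 1) / 2 by ring] at h2
  rw [show ((1 : ℝ) + 1) / 2 = 1 by norm_num, Real.Gamma_one]
  refine (mul_le_mul_of_nonneg_left h2 (by positivity)).trans_eq ?_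
  rw [Real.sqrt_div (by positivity), Real.sqrt_div (by positivity)]
  have h22 : √2 * √2 = (2 : ℝ) := Real.mul_self_sqrt (by norm_num)
  field_simp
  linarith

theorem integral_uniformSphere_abs_inner_sq {p : ℕ} (u : EuclideanSpace ℝ (Fin p))
    (hu : ‖u‖ = 1) :
    ∫ v : UnitSphere p, |inner ℝ u (v : EuclideanSpace ℝ (Fin p))| ^ 2 ∂uniformSphere p =
      1 / p := by
  have hp : 0 < p := by
    rw [Nat.pos_iff_ne_zero]
    rintro rfl
    simp [Subsingleton.elim u 0] at hu
  have hp0 : (0 : ℝ) < p := by exact_mod_cast hp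
  rw [integral_uniformSphere_abs_inner_pow u hu 2, Nat.cast_ofNat,
    show ((p : ℝ) + 2) / 2 = p / 2 + 1 by ring, show ((2 : ℝ) + 1) / 2 = 1 / 2 + 1 by ring,
    Real.Gamma_add_one (by positivity), Real.Gamma_add_one (by positivity),
    Real.Gamma_one_half_eq]
  have hG0 : 0 < Real.Gamma (p / 2) := Real.Gamma_pos_of_pos (by positivity)
  have hpi : 0 < √Real.pi := by positivity
  field_simp

/-! ### Deterministic bounds on the two optima -/

theorem posSemidef_gramInstance {n p : ℕ} (v : Fin n → UnitSphere p) :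
    (gramInstance v).PosSemidef := by
  refine .of_dotProduct_mulVec_nonneg ?_ fun x => ?_
  · ext i j
    simp [gramInstance, real_inner_comm]
  · have h : star x ⬝ᵥ (gramInstance v).mulVec x =
        inner ℝ (∑ i, x i • (v i : EuclideanSpace ℝ (Fin p)))
          (∑ i, x i • (v i : EuclideanSpace ℝ (Fin p))) / n := by
      simp only [sum_inner, inner_sum, real_inner_smul_left, real_inner_smul_right, dotProduct,
        Matrix.mulVec, gramInstance, Matrix.of_apply, Finset.sum_div, Finset.mul_sum, star_trivial]
      refine Finset.sum_congr rfl fun i _ => Finset.sum_congr rfl fun j _ => ?_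
      rw [real_inner_comm]
      ring
    rw [h]
    exact div_nonneg real_inner_self_nonneg n.cast_nonneg

theorem IQP_gramInstance {n p : ℕ} (v : Fin n → UnitSphere p) (x : Fin n → ℝ) :
    IQP (gramInstance v) x = ‖∑ i, x i • (v i : EuclideanSpace ℝ (Fin p))‖ ^ 2 / n := by
  rw [← real_inner_self_eq_norm_sq]
  simp only [IQP, sum_inner, inner_sum, real_inner_smul_left, real_inner_smul_right, dotProduct,
    Matrix.mulVec, gramInstance, Matrix.of_apply, Finset.sum_div, Finset.mul_sum]
  refine Finset.sum_congr rfl fun i _ => Finset.sum_congr rfl fun j _ => ?_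
  rw [real_inner_comm]
  ring

theorem iqpOpt_le_sdpOpt {n : ℕ} (A : Matrix (Fin n) (Fin n) ℝ) : iqpOpt A ≤ sdpOpt A := by
  obtain ⟨x, hx, hxA⟩ := (iqpOpt_isGreatest A).1
  rw [← hxA]
  refine (sdpOpt_isGreatest A).2 ⟨Matrix.vecMulVec x x, ⟨?_, fun i => ?_⟩, ?_⟩
  · simpa using Matrix.posSemidef_vecMulVec_self_star x
  · rcases hx i with h | h <;> simp [Matrix.vecMulVec_apply, h]
  · simp only [SDP, IQP, Matrix.trace, Matrix.diag, Matrix.mul_apply, Matrix.vecMulVec_apply,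
      dotProduct, Matrix.mulVec, Finset.mul_sum]
    refine Finset.sum_congr rfl fun i _ => Finset.sum_congr rfl fun j _ => ?_
    ring

/-- The Gram matrix and the `p × p` matrix `∑ vᵢ vᵢᵀ` have the same Frobenius norm. The latter has
trace `n`, so Cauchy–Schwarz on its diagonal suffices, the off-diagonal squares being dropped. -/
theorem sum_sum_inner_sq_ge {n p : ℕ} (v : Fin n → UnitSphere p) :
    (n : ℝ) ^ 2 ≤ p * ∑ i, ∑ j,
      inner ℝ (v i : EuclideanSpace ℝ (Fin p)) (v j : EuclideanSpace ℝ (Fin p)) ^ 2 := by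
  set c : Fin n → Fin p → ℝ := fun i k => (v i : EuclideanSpace ℝ (Fin p)) k with hc
  have hn : ∑ k, ∑ i, c i k * c i k = n := by
    rw [Finset.sum_comm]
    have : ∀ i, ∑ k, c i k * c i k = 1 := fun i => by
      have h : ‖(v i : EuclideanSpace ℝ (Fin p))‖ ^ 2 = 1 := by simp
      rw [EuclideanSpace.real_norm_sq_eq] at h
      rw [← h]
      exact Finset.sum_congr rfl fun k _ => (sq _).symm
    simp [this]
  have hin : ∀ i j, inner ℝ (v i : EuclideanSpace ℝ (Fin p)) (v j : EuclideanSpace ℝ (Fin p)) =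
      ∑ k, c i k * c j k := fun i j => by
    simp only [PiLp.inner_apply, hc]
    exact Finset.sum_congr rfl fun k _ => by simp [mul_comm]
  have hfrob : ∑ i, ∑ j, (∑ k, c i k * c j k) ^ 2 = ∑ k, ∑ l, (∑ i, c i k * c i l) ^ 2 := by
    simp only [sq, Finset.sum_mul_sum]
    calc _ = ∑ i, ∑ k, ∑ j, ∑ l, c i k * c j k * (c i l * c j l) :=
          Finset.sum_congr rfl fun i _ => Finset.sum_comm
      _ = ∑ k, ∑ i, ∑ j, ∑ l, c i k * c j k * (c i l * c j l) := Finset.sum_comm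
      _ = ∑ k, ∑ i, ∑ l, ∑ j, c i k * c j k * (c i l * c j l) :=
          Finset.sum_congr rfl fun k _ => Finset.sum_congr rfl fun i _ => Finset.sum_comm
      _ = ∑ k, ∑ l, ∑ i, ∑ j, c i k * c j k * (c i l * c j l) :=
          Finset.sum_congr rfl fun k _ => Finset.sum_comm
      _ = _ := by
          refine Finset.sum_congr rfl fun k _ => Finset.sum_congr rfl fun l _ =>
            Finset.sum_congr rfl fun i _ => Finset.sum_congr rfl fun j _ => ?_
          ring
  simp_rw [hin]
  rw [hfrob, ← hn]
  refine (sq_sum_le_card_mul_sum_sq (s := Finset.univ)).trans ?_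
  rw [Finset.card_univ, Fintype.card_fin]
  refine mul_le_mul_of_nonneg_left (Finset.sum_le_sum fun k _ => ?_) p.cast_nonneg
  exact Finset.single_le_sum (f := fun l => (∑ i, c i k * c i l) ^ 2)
    (fun l _ => sq_nonneg _) (Finset.mem_univ k)

theorem div_le_sdpOpt_gramInstance {n p : ℕ} (hn : 1 ≤ n) (hp : 1 ≤ p)
    (v : Fin n → UnitSphere p) : (n : ℝ) / p ≤ sdpOpt (gramInstance v) := by
  have hn0 : (0 : ℝ) < n := by exact_mod_cast hn
  have hp0 : (0 : ℝ) < p := by exact_mod_cast hp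
  have hmem : (n : ℝ) • gramInstance v ∈ elliptope n :=
    ⟨(posSemidef_gramInstance v).smul hn0.le, fun i => by simp [gramInstance, hn0.ne']⟩
  refine le_trans ?_ ((sdpOpt_isGreatest _).2 ⟨_, hmem, rfl⟩)
  have h : SDP (gramInstance v) ((n : ℝ) • gramInstance v) = (∑ i, ∑ j,
      inner ℝ (v i : EuclideanSpace ℝ (Fin p)) (v j : EuclideanSpace ℝ (Fin p)) ^ 2) / n := by
    simp only [SDP, Matrix.trace, Matrix.diag, Matrix.mul_apply, Matrix.smul_apply, gramInstance,
      Matrix.of_apply, smul_eq_mul, Finset.sum_div]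
    refine Finset.sum_congr rfl fun i _ => Finset.sum_congr rfl fun j _ => ?_
    rw [real_inner_comm]
    field_simp
  rw [h, div_le_div_iff₀ hp0 hn0]
  nlinarith [sum_sum_inner_sq_ge v]

theorem sdpOpt_gramInstance_pos {n p : ℕ} (hn : 1 ≤ n) (hp : 1 ≤ p)
    (v : Fin n → UnitSphere p) : 0 < sdpOpt (gramInstance v) :=
  lt_of_lt_of_le (by positivity) (div_le_sdpOpt_gramInstance hn hp v)

theorem optRatio_gramInstance_le_one {n p : ℕ} (hn : 1 ≤ n) (hp : 1 ≤ p)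
    (v : Fin n → UnitSphere p) : optRatio (gramInstance v) ≤ 1 :=
  (div_le_one (sdpOpt_gramInstance_pos hn hp v)).2 (iqpOpt_le_sdpOpt _)

/-- For an optimal `x`, test `y = ∑ xᵢ vᵢ` against its own direction: `‖y‖ = ∑ xᵢ ⟨u, vᵢ⟩ ≤ ∑ |⟨u,
vᵢ⟩|`. -/
theorem optRatio_gramInstance_le {n p : ℕ} (hn : 1 ≤ n) (hp : 1 ≤ p)
    (v : Fin n → UnitSphere p) {s : ℝ} (hs : 0 ≤ s)
    (h : ∀ u : EuclideanSpace ℝ (Fin p), ‖u‖ = 1 →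
      ∑ i, |inner ℝ u (v i : EuclideanSpace ℝ (Fin p))| ≤ n * s) :
    optRatio (gramInstance v) ≤ p * s ^ 2 := by
  have hn0 : (0 : ℝ) < n := by exact_mod_cast hn
  have hp0 : (0 : ℝ) < p := by exact_mod_cast hp
  have hI : iqpOpt (gramInstance v) ≤ n * s ^ 2 := by
    obtain ⟨x, hx, hxA⟩ := (iqpOpt_isGreatest (gramInstance v)).1
    rw [← hxA, IQP_gramInstance, div_le_iff₀ hn0]
    set y := ∑ i, x i • (v i : EuclideanSpace ℝ (Fin p)) with hy
    suffices hys : ‖y‖ ≤ n * s by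
      calc ‖y‖ ^ 2 ≤ (n * s) ^ 2 := by gcongr
        _ = n * s ^ 2 * n := by ring
    rcases eq_or_ne y 0 with h0 | h0
    · rw [h0, norm_zero]; positivity
    have hy0 : ‖y‖ ≠ 0 := norm_ne_zero_iff.2 h0
    refine le_trans ?_ (h (‖y‖⁻¹ • y) (by simp [norm_smul, hy0]))
    calc ‖y‖ = inner ℝ (‖y‖⁻¹ • y) y := by
          rw [real_inner_smul_left, real_inner_self_eq_norm_sq]; field_simp
      _ = ∑ i, x i * inner ℝ (‖y‖⁻¹ • y) (v i : EuclideanSpace ℝ (Fin p)) := by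
          conv_lhs => rw [hy, inner_sum, ← hy]
          simp only [real_inner_smul_right]
      _ ≤ _ := by
          refine Finset.sum_le_sum fun i _ => (le_abs_self _).trans_eq ?_
          rcases hx i with h | h <;> simp [h]
  have hS := div_le_sdpOpt_gramInstance hn hp v
  rw [optRatio, div_le_iff₀ (sdpOpt_gramInstance_pos hn hp v)]
  calc _ ≤ _ := hI
    _ = p * s ^ 2 * (n / p) := by field_simp
    _ ≤ _ := by gcongr

/-! ### A finite set of test directions -/

/-- Rounding is towards zero, so that rounding every coordinate does not increase the norm of a
vector. -/
theorem exists_int_div_near {n : ℕ} (hn : 1 ≤ n) (t : ℝ) (ht : |t| ≤ 1) :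
    ∃ k ∈ Finset.Icc (-(n : ℤ)) n, |(k : ℝ) / n| ≤ |t| ∧ |t - k / n| ≤ 1 / n := by
  have hn0 : (0 : ℝ) < n := by exact_mod_cast hn
  have key : ∀ t : ℝ, 0 ≤ t → t ≤ 1 →
      ∃ k ∈ Finset.Icc (-(n : ℤ)) n, |(k : ℝ) / n| ≤ |t| ∧ |t - k / n| ≤ 1 / n := by
    intro t h0 h1
    have ha := Int.floor_le (n * t)
    have hb := Int.lt_floor_add_one (n * t)
    have hc : 0 ≤ ⌊n * t⌋ := Int.floor_nonneg.2 (by positivity)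
    have hc' : (0 : ℝ) ≤ ⌊n * t⌋ := by exact_mod_cast hc
    have hd : ⌊n * t⌋ ≤ n := by
      have : (⌊n * t⌋ : ℝ) ≤ n := by nlinarith
      exact_mod_cast this
    refine ⟨⌊n * t⌋, Finset.mem_Icc.2 ⟨by omega, hd⟩, ?_, ?_⟩
    · rw [abs_of_nonneg (by positivity), abs_of_nonneg h0, div_le_iff₀ hn0]; linarith
    · rw [abs_le]
      constructor
      · have : (⌊n * t⌋ : ℝ) / n ≤ t := by rw [div_le_iff₀ hn0]; linarith
        have : 0 ≤ 1 / (n : ℝ) := by positivity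
        linarith
      · rw [sub_le_iff_le_add, ← add_div, le_div_iff₀ hn0]; linarith
  rcases le_total 0 t with h0 | h0
  · exact key t h0 (abs_le.1 ht).2
  · obtain ⟨k, hk, h1, h2⟩ := key (-t) (by linarith) (by linarith [(abs_le.1 ht).1])
    rw [Finset.mem_Icc] at hk
    refine ⟨-k, Finset.mem_Icc.2 ⟨by omega, by omega⟩, ?_, ?_⟩
    · rw [abs_neg] at h1
      rw [Int.cast_neg, neg_div, abs_neg]; exact h1
    · rw [← abs_neg]
      push_cast
      convert h2 using 2
      ring

theorem exists_unit_abs_inner_ge {p : ℕ} (hp : 1 ≤ p) (w : EuclideanSpace ℝ (Fin p))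
    (hw : ‖w‖ ≤ 1) : ∃ u : EuclideanSpace ℝ (Fin p), ‖u‖ = 1 ∧
      ∀ v : EuclideanSpace ℝ (Fin p), |inner ℝ w v| ≤ |inner ℝ u v| := by
  rcases eq_or_ne w 0 with rfl | h0
  · exact ⟨EuclideanSpace.single ⟨0, hp⟩ 1, by simp, fun v => by simp⟩
  · have hw0 : 0 < ‖w‖ := norm_pos_iff.2 h0
    refine ⟨‖w‖⁻¹ • w, by simp [norm_smul, hw0.ne'], fun v => ?_⟩
    rw [real_inner_smul_left, abs_mul, abs_inv, abs_norm]
    exact le_mul_of_one_le_left (abs_nonneg _) ((one_le_inv₀ hw0).2 hw)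

/-- Round `u` to the grid of mesh `1/n`, losing at most `1/n` per coordinate. The rounded point
stays in the unit ball, and normalizing it only increases `|⟨·, v⟩|`; only this one-sided comparison
is needed. -/
theorem exists_finset_unit_dominating {n p : ℕ} (hn : 1 ≤ n) (hp : 1 ≤ p) :
    ∃ T : Finset (EuclideanSpace ℝ (Fin p)), T.card ≤ (2 * n + 1) ^ p ∧ (∀ w ∈ T, ‖w‖ = 1) ∧
      ∀ u : EuclideanSpace ℝ (Fin p), ‖u‖ = 1 → ∃ w ∈ T, ∀ v : EuclideanSpace ℝ (Fin p),
        ‖v‖ ≤ 1 → |inner ℝ u v| ≤ |inner ℝ w v| + p / n := by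
  classical
  let pt : (Fin p → ℤ) → EuclideanSpace ℝ (Fin p) := fun z => WithLp.toLp 2 fun k => (z k : ℝ) / n
  have hex : ∀ z, ∃ u : EuclideanSpace ℝ (Fin p), ‖u‖ = 1 ∧
      (‖pt z‖ ≤ 1 → ∀ v : EuclideanSpace ℝ (Fin p), |inner ℝ (pt z) v| ≤ |inner ℝ u v|) := by
    intro z
    by_cases h : ‖pt z‖ ≤ 1
    · obtain ⟨u, hu, huv⟩ := exists_unit_abs_inner_ge hp _ h
      exact ⟨u, hu, fun _ => huv⟩
    -- Grid points outside the ball are never used; any unit vector serves.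
    · exact ⟨EuclideanSpace.single ⟨0, hp⟩ 1, by simp, fun h' => absurd h' h⟩
  choose g hg1 hg2 using hex
  refine ⟨(Fintype.piFinset fun _ : Fin p => Finset.Icc (-(n : ℤ)) n).image g, ?_, ?_, ?_⟩
  · refine Finset.card_image_le.trans_eq ?_
    rw [Fintype.card_piFinset, Finset.prod_const, Int.card_Icc, Finset.card_univ, Fintype.card_fin]
    congr 1
    omega
  · intro w hw
    obtain ⟨z, -, rfl⟩ := Finset.mem_image.1 hw
    exact hg1 z
  · intro u hu
    have hcoord : ∀ k, |u k| ≤ 1 := fun k => by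
      simpa [hu] using PiLp.norm_apply_le u k
    choose z hz1 hz2 hz3 using fun k => exists_int_div_near hn (u k) (hcoord k)
    refine ⟨g z, Finset.mem_image_of_mem _ (Fintype.mem_piFinset.2 hz1), fun v hv => ?_⟩
    have hnorm : ‖pt z‖ ≤ 1 := by
      rw [← hu, EuclideanSpace.norm_eq, EuclideanSpace.norm_eq]
      refine Real.sqrt_le_sqrt (Finset.sum_le_sum fun k _ => ?_)
      exact pow_le_pow_left₀ (norm_nonneg _) (hz2 k) 2
    have hdiff : |inner ℝ (u - pt z) v| ≤ p / n := by
      rw [PiLp.inner_apply]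
      refine (Finset.abs_sum_le_sum_abs _ _).trans ?_
      have : ∀ k, |inner ℝ ((u - pt z) k) (v k)| ≤ 1 / n := fun k => by
        have hv1 : |v k| ≤ 1 := by simpa using (PiLp.norm_apply_le v k).trans hv
        refine (abs_real_inner_le_norm _ _).trans ?_
        calc _ ≤ (1 / n : ℝ) * 1 := by
              refine mul_le_mul ?_ hv1 (norm_nonneg _) (by positivity)
              exact hz3 k
          _ = _ := mul_one _
      refine (Finset.sum_le_sum fun k _ => this k).trans_eq ?_
      simp [div_eq_mul_inv]
    calc |inner ℝ u v| = |inner ℝ (pt z) v + inner ℝ (u - pt z) v| := by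
          rw [← inner_add_left]; congr 2; abel
      _ ≤ |inner ℝ (pt z) v| + |inner ℝ (u - pt z) v| := abs_add_le _ _
      _ ≤ _ := add_le_add (hg2 z hnorm v) hdiff

/-! ### Chernoff and union bounds -/

theorem exp_le_one_add_add_sq {x : ℝ} (hx : |x| ≤ 1) : Real.exp x ≤ 1 + x + x ^ 2 := by
  have h := Real.abs_exp_sub_one_sub_id_le hx
  linarith [(abs_le.1 h).2]

/-- Since `l |⟨u, v⟩| ≤ 1`, the exponential is bounded by a quadratic, so the first two moments
suffice. -/
theorem integral_exp_abs_inner_le {p : ℕ} (u : EuclideanSpace ℝ (Fin p)) (hu : ‖u‖ = 1)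
    (hp : 1 ≤ p) {l : ℝ} (hl0 : 0 ≤ l) (hl1 : l ≤ 1) :
    ∫ v : UnitSphere p, Real.exp (l * |inner ℝ u (v : EuclideanSpace ℝ (Fin p))|)
      ∂uniformSphere p ≤ Real.exp (l * (√(2 / Real.pi) * (√(p + 1) / p)) + l ^ 2 / p) := by
  have := isProbabilityMeasure_uniformSphere hp
  have hin : ∀ v : UnitSphere p, |inner ℝ u (v : EuclideanSpace ℝ (Fin p))| ≤ 1 := fun v => by
    simpa [hu] using abs_real_inner_le_norm u (v : EuclideanSpace ℝ (Fin p))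
  have hint : ∀ g : UnitSphere p → ℝ, Continuous g → Integrable g (uniformSphere p) := fun g hg => by
    obtain ⟨C, hC⟩ := (isCompact_univ (X := UnitSphere p)).exists_bound_of_continuousOn
      hg.continuousOn
    exact Integrable.of_bound hg.aestronglyMeasurable C (.of_forall fun x => hC x (Set.mem_univ x))
  calc _ ≤ ∫ v : UnitSphere p, (1 + l * |inner ℝ u (v : EuclideanSpace ℝ (Fin p))|) +
          l ^ 2 * |inner ℝ u (v : EuclideanSpace ℝ (Fin p))| ^ 2 ∂uniformSphere p := by
        refine integral_mono (hint _ (by fun_prop)) (hint _ (by fun_prop)) fun v => ?_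
        have h := exp_le_one_add_add_sq
          (x := l * |inner ℝ u (v : EuclideanSpace ℝ (Fin p))|) (by
            rw [abs_of_nonneg (by positivity)]
            exact mul_le_one₀ hl1 (abs_nonneg _) (hin v))
        rwa [mul_pow] at h
    _ = 1 + l * (∫ v : UnitSphere p, |inner ℝ u (v : EuclideanSpace ℝ (Fin p))| ∂uniformSphere p)
          + l ^ 2 * (1 / p) := by
        rw [integral_add (hint _ (by fun_prop)) (hint _ (by fun_prop)),
          integral_add (hint _ (by fun_prop)) (hint _ (by fun_prop)), integral_const_mul,
          integral_const_mul, integral_uniformSphere_abs_inner_sq u hu]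
        simp
    _ ≤ 1 + l * (√(2 / Real.pi) * (√(p + 1) / p)) + l ^ 2 * (1 / p) := by
        gcongr
        exact integral_uniformSphere_abs_inner_le u hu
    _ ≤ _ := by
        have h := Real.add_one_le_exp (l * (√(2 / Real.pi) * (√(p + 1) / p)) + l ^ 2 / p)
        have : l ^ 2 * (1 / (p : ℝ)) = l ^ 2 / p := by ring
        linarith

theorem measure_sum_abs_inner_ge_le {n p : ℕ} (u : EuclideanSpace ℝ (Fin p)) (hu : ‖u‖ = 1)
    (hp : 1 ≤ p) {l : ℝ} (hl0 : 0 ≤ l) (hl1 : l ≤ 1) (t : ℝ) :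
    (randomUnitVectors n p).real
      {v | n * t ≤ ∑ i, |inner ℝ u (v i : EuclideanSpace ℝ (Fin p))|} ≤
      Real.exp (n * (l * (√(2 / Real.pi) * (√(p + 1) / p)) + l ^ 2 / p - l * t)) := by
  have := isProbabilityMeasure_uniformSphere hp
  set F : UnitSphere p → ℝ := fun v =>
    Real.exp (l * |inner ℝ u (v : EuclideanSpace ℝ (Fin p))|) with hF
  have hFc : Continuous F := by fun_prop
  obtain ⟨C, hC⟩ := (isCompact_univ (X := UnitSphere p)).exists_bound_of_continuousOn
      hFc.continuousOn
  have hFi : Integrable F (uniformSphere p) :=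
    Integrable.of_bound hFc.aestronglyMeasurable C (.of_forall fun x => hC x (Set.mem_univ x))
  have hm := mul_meas_ge_le_integral_of_nonneg (μ := randomUnitVectors n p)
    (f := fun v => ∏ i, F (v i)) (.of_forall fun v => Finset.prod_nonneg fun i _ => (Real.exp_pos _).le)
    (Integrable.fintype_prod fun _ => hFi) (Real.exp (n * (l * t)))
  have hset : {v : Fin n → UnitSphere p | Real.exp (n * (l * t)) ≤ ∏ i, F (v i)} ⊇
      {v | n * t ≤ ∑ i, |inner ℝ u (v i : EuclideanSpace ℝ (Fin p))|} := by
    intro v hv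
    simp only [Set.mem_ofPred_eq, hF] at hv ⊢
    rw [← Real.exp_sum, ← Finset.mul_sum, Real.exp_le_exp]
    nlinarith
  have hint : ∫ v, ∏ i, F (v i) ∂(randomUnitVectors n p) ≤
      Real.exp (n * (l * (√(2 / Real.pi) * (√(p + 1) / p)) + l ^ 2 / p)) := by
    rw [randomUnitVectors, integral_fintype_prod_eq_pow, Fintype.card_fin, Real.exp_nat_mul]
    exact pow_le_pow_left₀ (integral_nonneg fun v => (Real.exp_pos _).le)
      (integral_exp_abs_inner_le u hu hp hl0 hl1) n
  have : IsProbabilityMeasure (randomUnitVectors n p) := by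
    unfold randomUnitVectors; infer_instance
  rw [mul_sub, Real.exp_sub, le_div_iff₀ (Real.exp_pos _), mul_comm]
  refine le_trans ?_ (hm.trans hint)
  gcongr
  exact measure_ne_top _ _

theorem measure_compl_optRatio_le {n p : ℕ} (hn : 1 ≤ n) (hp : 1 ≤ p) {d : ℝ}
    (hd0 : 0 ≤ d) (hd : p * d ≤ 2) :
    (randomUnitVectors n p).real
      {v | optRatio (gramInstance v) ≤ p * (√(2 / Real.pi) * (√(p + 1) / p) + d + p / n) ^ 2}ᶜ ≤
      (2 * n + 1) ^ p * Real.exp (-(n * p * d ^ 2 / 4)) := by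
  have hn0 : (0 : ℝ) < n := by exact_mod_cast hn
  have hp0 : (0 : ℝ) < p := by exact_mod_cast hp
  have := isProbabilityMeasure_uniformSphere hp
  have : IsProbabilityMeasure (randomUnitVectors n p) := by
    unfold randomUnitVectors; infer_instance
  set M := √(2 / Real.pi) * (√((p : ℝ) + 1) / p) with hM
  obtain ⟨T, hTc, hT1, hT⟩ := exists_finset_unit_dominating hn hp
  have hsub : {v : Fin n → UnitSphere p |
      optRatio (gramInstance v) ≤ p * (M + d + p / n) ^ 2}ᶜ ⊆
      ⋃ w ∈ T, {v | n * (M + d) ≤ ∑ i, |inner ℝ w (v i : EuclideanSpace ℝ (Fin p))|} := by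
    intro v hv
    by_contra hcon
    simp only [Set.mem_iUnion, Set.mem_ofPred_eq, not_exists, not_le] at hcon
    refine hv (optRatio_gramInstance_le hn hp v (by positivity) fun u hu => ?_)
    obtain ⟨w, hw, hwv⟩ := hT u hu
    calc _ ≤ ∑ i, (|inner ℝ w (v i : EuclideanSpace ℝ (Fin p))| + p / n) :=
          Finset.sum_le_sum fun i _ => hwv _ (by simp)
      _ = ∑ i, |inner ℝ w (v i : EuclideanSpace ℝ (Fin p))| + n * (p / n) := by
          simp [Finset.sum_add_distrib]
      _ ≤ n * (M + d) + n * (p / n) := by gcongr; exact (hcon w hw).le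
      _ = _ := by ring
  refine (measureReal_mono hsub (measure_ne_top _ _)).trans ((measureReal_biUnion_finset_le _ _).trans ?_)
  have hE : ∀ w ∈ T, (randomUnitVectors n p).real
      {v | n * (M + d) ≤ ∑ i, |inner ℝ w (v i : EuclideanSpace ℝ (Fin p))|} ≤
      Real.exp (-(n * p * d ^ 2 / 4)) := by
    intro w hw
    -- `l = p d / 2` minimizes `l² / p - l d`, with value `-p d² / 4`; `hd` is exactly `l ≤ 1`.
    refine (measure_sum_abs_inner_ge_le w (hT1 w hw) hp (l := p * d / 2) (by positivity)
      (by linarith) (M + d)).trans_eq ?_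
    congr 1
    rw [← hM]
    field_simp
    ring
  refine (Finset.sum_le_sum hE).trans ?_
  rw [Finset.sum_const, nsmul_eq_mul]
  gcongr
  exact_mod_cast hTc

/-! ### Rates for `p` of order `n ^ (1 / 3)` -/

/-- Here `q = n ^ (1 / 3)`, `L = log n`. Expand the square with `e = L / √n + p / n`: everything
follows from `√(p + 1) * e = O(L / q)` and `1 / p = O(1 / q)`. -/
theorem ratio_bound_le {c C q L p n : ℝ} (hc : 0 < c) (hq : 1 ≤ q) (hL : 1 ≤ L) (hp : 1 ≤ p)
    (hcp : c * q ≤ p) (hpC : p ≤ C * q) (hn : n = q ^ 3) :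
    p * (√(2 / Real.pi) * (√(p + 1) / p) + L / √n + p / n) ^ 2 ≤
      2 / Real.pi + (1 / c + 2 * (√(2 * C) * (1 + C)) + (√(2 * C) * (1 + C)) ^ 2) *
        (L ^ 2 / q) := by
  have hq0 : 0 < q := by linarith
  have hp0 : 0 < p := by linarith
  have hC : 0 < C := by
    by_contra h
    nlinarith
  have hn0 : 0 < n := by rw [hn]; positivity
  set K := √(2 * C) * (1 + C) with hK
  have hK0 : 0 ≤ K := by positivity
  set a := √(2 / Real.pi) with ha
  have ha2 : a ^ 2 = 2 / Real.pi := Real.sq_sqrt (by positivity)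
  have hpi : 2 / Real.pi ≤ 1 := by
    rw [div_le_one Real.pi_pos]; linarith [Real.pi_gt_three]
  have ha0 : 0 ≤ a := Real.sqrt_nonneg _
  have ha1 : a ≤ 1 := Real.sqrt_le_one.2 hpi
  set s := √q with hs
  have hs2 : s ^ 2 = q := Real.sq_sqrt hq0.le
  have hs1 : 1 ≤ s := Real.one_le_sqrt.2 hq
  have hsq : s ≤ q := by nlinarith
  have hsn : √n = q * s := by
    rw [hn, show q ^ 3 = q ^ 2 * q by ring, Real.sqrt_mul (by positivity), Real.sqrt_sq hq0.le]
  set r := √(p + 1) with hr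
  have hr2 : r ^ 2 = p + 1 := Real.sq_sqrt (by linarith)
  have hr0 : 0 ≤ r := Real.sqrt_nonneg _
  have hrle : r ≤ √(2 * C) * s := by
    rw [hr, hs, ← Real.sqrt_mul (by positivity)]
    -- `p + 1 ≤ 2 p ≤ 2 C q`.
    exact Real.sqrt_le_sqrt (by nlinarith)
  set e := L / √n + p / n with he
  have he0 : 0 ≤ e := by positivity
  have hele : e ≤ L / (q * s) + C / q ^ 2 := by
    rw [he, hsn]
    refine add_le_add le_rfl ?_
    rw [hn, div_le_div_iff₀ (by positivity) (by positivity)]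
    nlinarith [mul_le_mul_of_nonneg_right hpC (sq_nonneg q)]
  have hre : r * e ≤ K * (L / q) := by
    calc r * e ≤ (√(2 * C) * s) * (L / (q * s) + C / q ^ 2) := by gcongr
      _ = √(2 * C) * (L / q + C * (s / q) / q) := by field_simp
      _ ≤ √(2 * C) * (L / q + C * L / q) := by
          gcongr
          exact ((div_le_one hq0).2 hsq).trans hL
      _ = K * (L / q) := by rw [hK]; ring
  have hre0 : 0 ≤ r * e := by positivity
  have h1 : p * (a * (r / p)) ^ 2 = 2 / Real.pi + 2 / Real.pi / p := by
    rw [← ha2]; field_simp; rw [hr2]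
  have h2 : 2 / Real.pi / p ≤ 1 / c * (L ^ 2 / q) := by
    calc 2 / Real.pi / p ≤ 1 / (c * q) := by gcongr
      _ = 1 / c * (1 / q) := by field_simp
      _ ≤ _ := by gcongr; exact one_le_pow₀ hL
  have h3 : a * (r * e) ≤ K * (L ^ 2 / q) := by
    calc a * (r * e) ≤ 1 * (K * (L / q)) := by gcongr
      _ = K * (L / q) := one_mul _
      _ ≤ _ := by gcongr; exact le_self_pow₀ hL two_ne_zero
  have h4 : p * e ^ 2 ≤ K ^ 2 * (L ^ 2 / q) := by
    calc p * e ^ 2 ≤ r ^ 2 * e ^ 2 := by rw [hr2]; gcongr; linarith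
      _ = (r * e) ^ 2 := by ring
      _ ≤ (K * (L / q)) ^ 2 := by gcongr
      _ = K ^ 2 * (L ^ 2 / q ^ 2) := by ring
      _ ≤ _ := by gcongr; exact le_self_pow₀ hq two_ne_zero
  rw [add_assoc, ← he]
  calc p * (a * (r / p) + e) ^ 2 = p * (a * (r / p)) ^ 2 + 2 * (a * (r * e)) + p * e ^ 2 := by
        field_simp
        ring
    _ ≤ (2 / Real.pi + 1 / c * (L ^ 2 / q)) + 2 * (K * (L ^ 2 / q)) + K ^ 2 * (L ^ 2 / q) := by
        rw [h1]; gcongr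
    _ = _ := by ring

theorem failure_bound_le {n p : ℕ} (hn : 3 ≤ n) (hp : 1 ≤ p) (hL : 12 ≤ Real.log n) :
    (2 * (n : ℝ) + 1) ^ p * Real.exp (-(n * p * (Real.log n / √n) ^ 2 / 4)) ≤ 1 / n := by
  have hn0 : (3 : ℝ) ≤ n := by exact_mod_cast hn
  have hp0 : (1 : ℝ) ≤ p := by exact_mod_cast hp
  set L := Real.log n with hLdef
  have hlog : 2 * (n : ℝ) + 1 ≤ Real.exp (2 * L) := by
    rw [two_mul L, Real.exp_add, hLdef, Real.exp_log (by linarith)]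
    nlinarith
  have hrhs : (1 : ℝ) / n = Real.exp (-L) := by
    rw [Real.exp_neg, hLdef, Real.exp_log (by linarith), one_div]
  have hd : (n : ℝ) * p * (L / √n) ^ 2 / 4 = p * L ^ 2 / 4 := by
    rw [div_pow, Real.sq_sqrt (by linarith)]
    field_simp
  rw [hrhs, hd]
  calc _ ≤ Real.exp (2 * L) ^ p * Real.exp (-(p * L ^ 2 / 4)) := by gcongr
    _ = Real.exp (p * (2 * L - L ^ 2 / 4)) := by
        rw [← Real.exp_nat_mul, ← Real.exp_add]; ring_nf
    _ ≤ _ := by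
        rw [Real.exp_le_exp]
        -- This is where `12 ≤ L` is used: it says `3 L ≤ L² / 4`.
        have : 2 * L - L ^ 2 / 4 ≤ -L := by nlinarith
        nlinarith

theorem exists_softO_bound (p : ℕ → ℕ) (hp_pos : ∀ n : ℕ, 1 ≤ n → 1 ≤ p n)
    (hp : (fun n : ℕ => (p n : ℝ)) =Θ[atTop] fun n : ℕ => (n : ℝ) ^ (1 / 3 : ℝ)) :
    ∃ (K : ℝ) (N : ℕ), ∀ n : ℕ, N ≤ n → 3 ≤ n ∧
      (randomUnitVectors n (p n)).real {v | optRatio (gramInstance v) ≤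
        2 / Real.pi + K * (Real.log n ^ 2 / (n : ℝ) ^ (1 / 3 : ℝ))}ᶜ ≤ 1 / n := by
  obtain ⟨C, hC0, hC⟩ := hp.1.exists_pos
  obtain ⟨c, hc0, hc⟩ := hp.2.exists_pos
  have hlog : ∀ᶠ n : ℕ in atTop, 12 ≤ Real.log n :=
    (Real.tendsto_log_atTop.comp tendsto_natCast_atTop_atTop).eventually_ge_atTop 12
  -- As `√n = n ^ (1 / 3) * n ^ (1 / 6)` and `p n ≤ C * n ^ (1 / 3)`, this yields the condition `p d
  -- ≤ 2` of the Chernoff bound.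
  have hsmall : ∀ᶠ n : ℕ in atTop, ‖Real.log n‖ ≤ 2 / C * ‖(n : ℝ) ^ (1 / 6 : ℝ)‖ :=
    tendsto_natCast_atTop_atTop.eventually
      ((isLittleO_log_rpow_atTop (r := 1 / 6) (by norm_num)).def (by positivity))
  obtain ⟨N, hN⟩ := eventually_atTop.1
    (hC.bound.and (hc.bound.and (hlog.and (hsmall.and (eventually_ge_atTop 3)))))
  refine ⟨1 / c⁻¹ + 2 * (√(2 * C) * (1 + C)) + (√(2 * C) * (1 + C)) ^ 2, N, fun n hn => ?_⟩
  obtain ⟨h1, h2, h3, h4, h5⟩ := hN n hn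
  refine ⟨h5, ?_⟩
  have hn3 : (3 : ℝ) ≤ n := by exact_mod_cast h5
  have hn0 : (0 : ℝ) < n := by linarith
  have hp1 := hp_pos n (by omega)
  set q := (n : ℝ) ^ (1 / 3 : ℝ) with hq
  have hq1 : 1 ≤ q := Real.one_le_rpow (by linarith) (by norm_num)
  have hq3 : (n : ℝ) = q ^ 3 := by
    rw [hq, ← Real.rpow_natCast, ← Real.rpow_mul hn0.le]; norm_num
  have h6 : 0 < (n : ℝ) ^ (1 / 6 : ℝ) := by positivity
  have hsn : √n = q * (n : ℝ) ^ (1 / 6 : ℝ) := by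
    rw [hq, ← Real.rpow_add hn0, Real.sqrt_eq_rpow]; norm_num
  rw [Real.norm_of_nonneg (by positivity), Real.norm_of_nonneg (by positivity)] at h1 h2
  rw [Real.norm_of_nonneg (by linarith), Real.norm_of_nonneg h6.le] at h4
  have hpd : (p n : ℝ) * (Real.log n / √n) ≤ 2 := by
    rw [hsn, ← mul_div_assoc, div_le_iff₀ (by positivity)]
    calc (p n : ℝ) * Real.log n ≤ (C * q) * (2 / C * (n : ℝ) ^ (1 / 6 : ℝ)) := by
          gcongr
      _ = _ := by field_simp
  have hb := ratio_bound_le (c := c⁻¹) (C := C) (q := q) (L := Real.log n) (p := p n) (n := n)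
    (by positivity) hq1 (by linarith) (by exact_mod_cast hp1)
    (by rw [inv_mul_le_iff₀ hc0]; exact h2) h1 hq3
  refine le_trans (measureReal_mono ?_ ?_) ((measure_compl_optRatio_le (by omega) hp1
    (by positivity) hpd).trans (failure_bound_le h5 hp1 h3))
  · exact Set.compl_subset_compl.2 fun v hv => le_trans hv hb
  · have := isProbabilityMeasure_uniformSphere hp1
    unfold randomUnitVectors
    exact measure_ne_top _ _

end PSDGrothendieck

theorem mainTheorem5 (p : ℕ → ℕ) (hp_pos : ∀ n : ℕ, 1 ≤ n → 1 ≤ p n)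
    (hp : (fun n : ℕ => (p n : ℝ)) =Θ[atTop] fun n : ℕ => (n : ℝ) ^ (1 / 3 : ℝ)) :
    ∃ err : ℕ → ℝ,
      PSDGrothendieck.IsSoftO err (fun n : ℕ => 1 / (n : ℝ) ^ (1 / 3 : ℝ)) ∧
      (∀ n : ℕ, 1 ≤ n → ∃ v : Fin n → PSDGrothendieck.UnitSphere (p n),
        (PSDGrothendieck.gramInstance v).PosSemidef ∧
        0 < PSDGrothendieck.sdpOpt (PSDGrothendieck.gramInstance v) ∧
        PSDGrothendieck.optRatio (PSDGrothendieck.gramInstance v) ≤ 2 / Real.pi + err n) ∧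
      Tendsto
        (fun n : ℕ => PSDGrothendieck.randomUnitVectors n (p n)
          {v | (PSDGrothendieck.gramInstance v).PosSemidef ∧
            0 < PSDGrothendieck.sdpOpt (PSDGrothendieck.gramInstance v) ∧
            PSDGrothendieck.optRatio (PSDGrothendieck.gramInstance v) ≤
              2 / Real.pi + err n})
        atTop (𝓝 1) := by
  obtain ⟨K, N, hKN⟩ := PSDGrothendieck.exists_softO_bound p hp_pos hp
  have hprob : ∀ n : ℕ, 1 ≤ n →
      IsProbabilityMeasure (PSDGrothendieck.randomUnitVectors n (p n)) := fun n hn => by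
    have := PSDGrothendieck.isProbabilityMeasure_uniformSphere (hp_pos n hn)
    unfold PSDGrothendieck.randomUnitVectors
    infer_instance
  -- Below `N` the value `1` is enough because the ratio never exceeds `1`.
  refine ⟨fun n => if n < N then 1 else K * (Real.log n ^ 2 / (n : ℝ) ^ (1 / 3 : ℝ)),
    ⟨2, ?_⟩, ?_, ?_⟩
  · refine IsBigO.of_bound |K| ((eventually_ge_atTop N).mono fun n hn => ?_)
    simp only [if_neg hn.not_gt]
    rw [← Real.norm_eq_abs, ← norm_mul]
    exact le_of_eq (congrArg _ (by ring))
  · intro n hn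
    by_cases hnN : n < N
    · refine ⟨fun _ => ⟨EuclideanSpace.single ⟨0, hp_pos n hn⟩ 1, by simp⟩,
        PSDGrothendieck.posSemidef_gramInstance _,
        PSDGrothendieck.sdpOpt_gramInstance_pos hn (hp_pos n hn) _, ?_⟩
      simp only [if_pos hnN]
      have : 0 < 2 / Real.pi := by positivity
      linarith [PSDGrothendieck.optRatio_gramInstance_le_one hn (hp_pos n hn)
        fun _ => ⟨EuclideanSpace.single ⟨0, hp_pos n hn⟩ 1, by simp⟩]
    · obtain ⟨h3, hb⟩ := hKN n (not_lt.1 hnN)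
      simp only [if_neg hnN]
      -- Were there no good configuration, the failure event would have probability `1`, against the
      -- bound `1 / n` with `n ≥ 3`.
      by_contra! hcon
      have := hprob n hn
      rw [show {v : Fin n → PSDGrothendieck.UnitSphere (p n) | PSDGrothendieck.optRatio
          (PSDGrothendieck.gramInstance v) ≤
            2 / Real.pi + K * (Real.log n ^ 2 / (n : ℝ) ^ (1 / 3 : ℝ))}ᶜ = Set.univ from
        Set.eq_univ_of_forall fun v hv => absurd hv (hcon v
          (PSDGrothendieck.posSemidef_gramInstance v)
          (PSDGrothendieck.sdpOpt_gramInstance_pos hn (hp_pos n hn) v)).not_ge,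
        probReal_univ] at hb
      have h3' : (3 : ℝ) ≤ n := by exact_mod_cast h3
      rw [le_div_iff₀ (by linarith)] at hb
      linarith
  · have hlim : Tendsto (fun n : ℕ => 1 - ENNReal.ofReal (1 / n)) atTop (𝓝 1) := by
      have h := ENNReal.Tendsto.sub (tendsto_const_nhds (x := (1 : ENNReal)) (f := atTop))
        (ENNReal.tendsto_ofReal tendsto_one_div_atTop_nhds_zero_nat) (Or.inl ENNReal.one_ne_top)
      simpa using h
    refine tendsto_of_tendsto_of_tendsto_of_le_of_le' hlim tendsto_const_nhds ?_ ?_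
    · refine (eventually_ge_atTop N).mono fun n hn => ?_
      obtain ⟨h3, hb⟩ := hKN n hn
      have := hprob n (by omega)
      simp only [if_neg hn.not_gt]
      set G := {v : Fin n → PSDGrothendieck.UnitSphere (p n) | PSDGrothendieck.optRatio
          (PSDGrothendieck.gramInstance v) ≤
            2 / Real.pi + K * (Real.log n ^ 2 / (n : ℝ) ^ (1 / 3 : ℝ))} with hG
      rw [tsub_le_iff_right]
      calc (1 : ENNReal) = PSDGrothendieck.randomUnitVectors n (p n) (G ∪ Gᶜ) := by
            rw [Set.union_compl_self, measure_univ]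
        _ ≤ _ := measure_union_le _ _
        _ ≤ _ := by
            refine add_le_add (measure_mono fun v hv => ⟨PSDGrothendieck.posSemidef_gramInstance v,
              PSDGrothendieck.sdpOpt_gramInstance_pos (by omega) (hp_pos n (by omega)) v, hv⟩) ?_
            rw [← ofReal_measureReal]
            exact ENNReal.ofReal_le_ofReal hb
    · refine (eventually_ge_atTop 1).mono fun n hn => ?_
      have := hprob n hn
      exact prob_le_one
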